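/- Let $V$ be an operator space, that is, a complex vector space with a norm $\|\cdot\|_{M_n(V)}$ on each space $M_n(V)$ of $n\times n$ matrices over $V$ such that $\|A\cdot X\cdot B^*\|_{M_p(V)}\le\|A\|\,\|X\|_{M_n(V)}\,\|B\|$ for all $X\in M_n(V)$ and $A,B\in M_{p,n}(\mathbb C)$, and $\|X\oplus Y\|_{M_{n+p}(V)}=\max\{\|X\|_{M_n(V)},\|Y\|_{M_p(V)}\}$ for all $X\in M_n(V)$, $Y\in M_p(V)$. Here $A\cdot X\cdot B^*=\big(\sum_{a,b}A_{ia}\overline{B_{jb}}\,X_{ab}\big)_{i,j}$ and scalar matrices carry the operator norm. For an integer $k\ge 1$ and $X=(X_{ij})\in M_m(V)$ let $$\|X\|_{M_m(MAX^k(V))}=\sup\big\{\|(\Phi(X_{ij}))\| : \mathcal H \text{ a complex Hilbert space},\ \Phi:V\to\mathcal B(\mathcal H)\text{ linear},\ \|id_k\otimes\Phi\|\le 1\big\},$$ where $M_n(\mathcal B(\mathcal H))$ is normed as $\mathcal B(\mathcal H^n)$ and $\|id_k\otimes\Phi\|$ is the norm of the map $(Y_{ij})\mapsto(\Phi(Y_{ij}))$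 from $M_k(V)$ to $M_k(\mathcal B(\mathcal H))$. Then for every integer $k\ge1$ and every $X\in M_m(V)$ this supremum is finite, $X$ has at least one factorization of the form below, and $$\|X\|_{M_m(MAX^k(V))}=\inf\big\{\|A\|\,\|B\| : r\ge 1,\ A,B\in M_{m,rk}(\mathbb C),\ x_1,\dots,x_r\in M_k(V),\ \|x_s\|_{M_k(V)}\le 1,\ X=A\cdot\mathrm{diag}(x_1,\dots,x_r)\cdot B^*\big\},$$ where $\mathrm{diag}(x_1,\dots,x_r)\in M_{rk}(V)$ is the block diagonal matrix with diagonal blocks $x_1,\dots,x_r$. -/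

import Mathlib

open scoped Matrix.Norms.L2Operator ENNReal

universe u w

/-- `A · X · B*` for scalar matrices `A`, `B` and a matrix `X` with entries in a complex vector
space: the `(i, j)` entry is `∑ a b, A i a * conj (B j b) • X a b`. -/
def sandwich {V : Type u} [AddCommGroup V] [Module ℂ V] {p n : Type*} [Fintype n]
    (A : Matrix p n ℂ) (X : Matrix n n V) (B : Matrix p n ℂ) : Matrix p p V :=
  Matrix.of fun i j => ∑ a, ∑ b, (A i a * star (B j b)) • X a b

/-- The direct sum `X ⊕ Y ∈ M_{m+p}(V)` of `X ∈ M_m(V)` and `Y ∈ M_p(V)`. -/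
def matrixDirectSum {V : Type u} [AddCommGroup V] {m p : ℕ}
    (X : Matrix (Fin m) (Fin m) V) (Y : Matrix (Fin p) (Fin p) V) :
    Matrix (Fin (m + p)) (Fin (m + p)) V :=
  Matrix.reindex finSumFinEquiv finSumFinEquiv (Matrix.fromBlocks X 0 0 Y)

/-- An (abstract) operator space structure on a complex vector space `V`: a norm on each
`M_n(V)`, such that the family is a matrix norm with the `L^∞` property. Scalar matrices carry the
operator norm with respect to the Euclidean norms. The degenerate size `n = 0` adds nothing, since
`M_0(V)` is the zero space. -/
class OperatorSpace (V : Type u) [AddCommGroup V] [Module ℂ V] where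
  matNorm : ∀ n : ℕ, Matrix (Fin n) (Fin n) V → ℝ
  matNorm_nonneg : ∀ (n : ℕ) (X : Matrix (Fin n) (Fin n) V), 0 ≤ matNorm n X
  matNorm_eq_zero_iff : ∀ (n : ℕ) (X : Matrix (Fin n) (Fin n) V), matNorm n X = 0 ↔ X = 0
  matNorm_smul : ∀ (n : ℕ) (c : ℂ) (X : Matrix (Fin n) (Fin n) V),
    matNorm n (c • X) = ‖c‖ * matNorm n X
  matNorm_add_le : ∀ (n : ℕ) (X Y : Matrix (Fin n) (Fin n) V),
    matNorm n (X + Y) ≤ matNorm n X + matNorm n Y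
  matNorm_sandwich_le : ∀ (p m : ℕ) (A B : Matrix (Fin p) (Fin m) ℂ)
    (X : Matrix (Fin m) (Fin m) V),
    matNorm p (sandwich A X B) ≤ ‖A‖ * matNorm m X * ‖B‖
  matNorm_directSum : ∀ (m p : ℕ) (X : Matrix (Fin m) (Fin m) V) (Y : Matrix (Fin p) (Fin p) V),
    matNorm (m + p) (matrixDirectSum X Y) = max (matNorm m X) (matNorm p Y)

noncomputable section

/-- The operator on the Hilbert space direct sum `H^m` given by an `m × m` matrix of bounded
operators on `H`; this is the identification of `M_m(B(H))` with `B(H^m)`. -/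
def opMatrix {H : Type w} [NormedAddCommGroup H] [InnerProductSpace ℂ H] {m : ℕ}
    (T : Matrix (Fin m) (Fin m) (H →L[ℂ] H)) :
    PiLp 2 (fun _ : Fin m => H) →L[ℂ] PiLp 2 (fun _ : Fin m => H) :=
  ((PiLp.continuousLinearEquiv 2 ℂ (fun _ : Fin m => H)).symm :
      (Fin m → H) →L[ℂ] PiLp 2 (fun _ : Fin m => H)) ∘L
    ContinuousLinearMap.pi fun i => ∑ j, (T i j) ∘L (PiLp.proj 2 (fun _ : Fin m => H) j)

theorem opMatrix_apply {H : Type w} [NormedAddCommGroup H] [InnerProductSpace ℂ H] {m : ℕ}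
    (T : Matrix (Fin m) (Fin m) (H →L[ℂ] H)) (x : PiLp 2 (fun _ : Fin m => H)) (i : Fin m) :
    opMatrix T x i = ∑ j, T i j (x j) := by
  simp [opMatrix]

/-- The norm of `id_k ⊗ Φ : M_k(V) → M_k(B(H))`, with values in `[0, ∞]`. -/
def ampNorm {V : Type u} [AddCommGroup V] [Module ℂ V] [OperatorSpace V]
    {H : Type w} [NormedAddCommGroup H] [InnerProductSpace ℂ H]
    (k : ℕ) (Φ : V →ₗ[ℂ] (H →L[ℂ] H)) : ℝ≥0∞ :=
  ⨆ (Y : Matrix (Fin k) (Fin k) V) (_ : OperatorSpace.matNorm k Y ≤ 1),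
    ENNReal.ofReal ‖opMatrix (Y.map Φ)‖

/-- The values `‖(Φ(X_{ij}))‖`, where `Φ` runs over the linear maps from `V` into the bounded
operators on some complex Hilbert space such that `‖id_k ⊗ Φ‖ ≤ 1`. -/
def kMaxValues {V : Type u} [AddCommGroup V] [Module ℂ V] [OperatorSpace V]
    (k : ℕ) {m : ℕ} (X : Matrix (Fin m) (Fin m) V) : Set ℝ :=
  {c | ∃ (H : Type w) (_ : NormedAddCommGroup H) (_ : InnerProductSpace ℂ H)
      (_ : CompleteSpace H) (Φ : V →ₗ[ℂ] (H →L[ℂ] H)),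
      ampNorm k Φ ≤ 1 ∧ c = ‖opMatrix (X.map Φ)‖}

/-- The norm of `X` in `M_m(MAX^k(V))`. -/
def kMaxNorm {V : Type u} [AddCommGroup V] [Module ℂ V] [OperatorSpace V]
    (k : ℕ) {m : ℕ} (X : Matrix (Fin m) (Fin m) V) : ℝ :=
  sSup (kMaxValues.{u, w} k X)

/-- The numbers `‖A‖ ‖B‖` over all factorizations `X = A · diag(x_1, …, x_r) · B*` with `r ≥ 1`,
`A, B ∈ M_{m,rk}` and `x_1, …, x_r` in the unit ball of `M_k(V)`. The `rk` columns are labelled by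
pairs (position inside a block, number of the block), as in `Matrix.blockDiagonal`. -/
def factorizationValues {V : Type u} [AddCommGroup V] [Module ℂ V] [OperatorSpace V]
    (k : ℕ) {m : ℕ} (X : Matrix (Fin m) (Fin m) V) : Set ℝ :=
  {c | ∃ (r : ℕ) (_ : 1 ≤ r) (A B : Matrix (Fin m) (Fin k × Fin r) ℂ)
      (x : Fin r → Matrix (Fin k) (Fin k) V),
      (∀ s, OperatorSpace.matNorm k (x s) ≤ 1) ∧
      X = sandwich A (Matrix.blockDiagonal x) B ∧ c = ‖A‖ * ‖B‖}

end

/-!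
For Hermitian `P, Q ∈ M_m(ℂ)`, the triples `(P, Q, Y)` for which `Y = ∑ a_s x_s b_s*` with `x_s` in
the unit ball `K` of `M_k(V)`, `∑ a_s a_s* ≤ P` and `∑ b_s b_s* ≤ Q` form a convex cone with order
unit `(1, 1, 0)`, and `(t, t, X)` lies in the cone exactly when `X` has a factorization with
`‖A‖, ‖B‖ ≤ √t`. If it does not lie in the cone, Hahn–Banach gives positive functionals `p`, `q` on
`M_m(ℂ)` and a functional `f` on `M_m(V)` with `2 Re f(a x b*) ≤ p(a a*) + q(b b*)` for `x ∈ K`,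
`p(1) + q(1) = 2` and `Re f(X) ≥ t`. After adding a small multiple of the trace to `p` and `q`, they
are vector functionals of two bases `η`, `ξ` of `ℂ^m`. As these are bases, `f` is of the form
`Y ↦ ⟪η, Φ_m(Y) ξ⟫` for a linear map `Φ : V → B(ℂ^m)`, and as every vector of `(ℂ^m)^k` is of the
form `a* η`, the inequality for `f` says that `‖id_k ⊗ Φ‖ ≤ 1`.
-/

noncomputable section

open Filter
open scoped ComplexOrder MatrixOrder Matrix ComplexStarModule InnerProductSpace Topology

section Sandwich

variable {V : Type*} [AddCommGroup V] [Module ℂ V] {p n r : Type*} [Fintype n]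

theorem sandwich_zero_left (x : Matrix n n V) (b : Matrix p n ℂ) :
    sandwich (0 : Matrix p n ℂ) x b = 0 := by
  ext i j
  simp [sandwich]

theorem sandwich_zero (a b : Matrix p n ℂ) : sandwich a (0 : Matrix n n V) b = 0 := by
  ext i j
  simp [sandwich]

theorem sandwich_add (a b : Matrix p n ℂ) (x y : Matrix n n V) :
    sandwich a (x + y) b = sandwich a x b + sandwich a y b := by
  ext i j
  simp [sandwich, Finset.sum_add_distrib]

theorem sandwich_smul (c : ℂ) (a b : Matrix p n ℂ) (x : Matrix n n V) :
    sandwich a (c • x) b = sandwich (c • a) x b := by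
  ext i j
  simp only [sandwich, Matrix.smul_apply, Matrix.of_apply, smul_smul, smul_eq_mul,
    mul_right_comm, mul_comm c]

theorem sandwich_smul_smul (s t : ℂ) (a b : Matrix p n ℂ) (x : Matrix n n V) :
    sandwich (s • a) x (t • b) = (s * star t) • sandwich a x b := by
  ext i j
  simp only [sandwich, Matrix.smul_apply, Matrix.of_apply, Finset.smul_sum, smul_smul,
    smul_eq_mul, star_mul', mul_mul_mul_comm]

theorem sandwich_single [DecidableEq p] [DecidableEq n] (i j : p) (c d : n) (s t : ℂ) (v : V) :
    sandwich (Matrix.single i c s) (Matrix.single c d v) (Matrix.single j d t) =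
      Matrix.single i j ((s * star t) • v) := by
  ext i' j'
  simp only [sandwich, Matrix.of_apply, Matrix.single_apply]
  rw [Fintype.sum_eq_single c fun c' hc => by simp [hc.symm],
    Fintype.sum_eq_single d fun d' hd => by simp [hd.symm]]
  by_cases hi : i = i' <;> by_cases hj : j = j' <;> simp [hi, hj]

/-- The block `A_s` of a matrix `A = (A_1, …, A_r)` whose columns are labelled by pairs
(position inside a block, number of the block), as in `Matrix.blockDiagonal`. -/
def blockColumns (A : Matrix p (n × r) ℂ) (s : r) : Matrix p n ℂ :=
  Matrix.of fun i c => A i (c, s)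

theorem mul_conjTranspose_eq_sum_blockColumns [Fintype r] (A : Matrix p (n × r) ℂ) :
    A * Aᴴ = ∑ s, blockColumns A s * (blockColumns A s)ᴴ := by
  ext i j
  simp only [Matrix.mul_apply, Matrix.conjTranspose_apply, Matrix.sum_apply, blockColumns,
    Matrix.of_apply, Fintype.sum_prod_type]
  exact Finset.sum_comm

theorem sandwich_blockDiagonal [Fintype r] [DecidableEq r] (A B : Matrix p (n × r) ℂ)
    (x : r → Matrix n n V) :
    sandwich A (Matrix.blockDiagonal x) B =
      ∑ s, sandwich (blockColumns A s) (x s) (blockColumns B s) := by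
  ext i j
  simp only [sandwich, blockColumns, Matrix.of_apply, Matrix.sum_apply, Fintype.sum_prod_type,
    Matrix.blockDiagonal_apply, smul_ite, smul_zero, Finset.sum_ite_eq, Finset.mem_univ, if_true]
  exact Finset.sum_comm

end Sandwich

section Norm

variable {p n : Type*} [Fintype p] [Fintype n] [DecidableEq p] [DecidableEq n]

theorem mul_conjTranspose_le_smul_one_iff (A : Matrix p n ℂ) {s : ℝ} (hs : 0 ≤ s) :
    A * Aᴴ ≤ s • (1 : Matrix p p ℂ) ↔ ‖A‖ ^ 2 ≤ s := by
  have hnorm : ‖A * Aᴴ‖ = ‖A‖ ^ 2 := by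
    simpa [sq, Matrix.l2_opNorm_conjTranspose] using Matrix.l2_opNorm_conjTranspose_mul_self Aᴴ
  have hpos : 0 ≤ A * Aᴴ := (Matrix.posSemidef_self_mul_conjTranspose A).nonneg
  rw [← hnorm, CStarAlgebra.norm_le_iff_le_algebraMap _ hs hpos, Algebra.algebraMap_eq_smul_one]

theorem realPart_le_norm_smul_one (P : Matrix p p ℂ) : (ℜ P : Matrix p p ℂ) ≤ ‖P‖ • 1 := by
  calc (ℜ P : Matrix p p ℂ) ≤ algebraMap ℝ _ ‖(ℜ P : Matrix p p ℂ)‖ :=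
        (ℜ P).2.le_algebraMap_norm_self
    _ ≤ ‖P‖ • 1 := by
      rw [Algebra.algebraMap_eq_smul_one]
      exact smul_le_smul_of_nonneg_right (realPart.norm_le P) zero_le_one

end Norm

section AdjointAct

variable {H : Type*} [NormedAddCommGroup H] [InnerProductSpace ℂ H]
  {p n r : Type*} [Fintype p] [Fintype n] [Fintype r]

/-- The action `A* η` of the adjoint of a scalar matrix on a vector `η` of a direct sum `H^p`. -/
def adjointAct (A : Matrix p n ℂ) (η : PiLp 2 fun _ : p => H) : PiLp 2 fun _ : n => H :=
  WithLp.toLp 2 fun c => ∑ i, star (A i c) • η i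

/-- The vector of `H^p` whose components are the elements of a basis of `H` indexed by `p`. -/
def basisTuple (η : Module.Basis p ℂ H) : PiLp 2 fun _ : p => H :=
  WithLp.toLp 2 η

/-- The linear functional `P ↦ ∑ P_ij ⟪η_i, η_j⟫` on scalar matrices, the vector functional of `η`.
It is normalised so that its value at `a a*` is `‖a* η‖²`. -/
def vectorFunctional (η : PiLp 2 fun _ : p => H) : Matrix p p ℂ →ₗ[ℂ] ℂ :=
  ∑ i, ∑ j, ⟪η i, η j⟫_ℂ • Matrix.entryLinearMap ℂ ℂ i j

theorem vectorFunctional_apply (η : PiLp 2 fun _ : p => H) (P : Matrix p p ℂ) :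
    vectorFunctional η P = ∑ i, ∑ j, ⟪η i, η j⟫_ℂ * P i j := by
  simp [vectorFunctional]

theorem vectorFunctional_one [DecidableEq p] (η : PiLp 2 fun _ : p => H) :
    vectorFunctional η 1 = (‖η‖ ^ 2 : ℝ) := by
  simp [vectorFunctional_apply, Matrix.one_apply, PiLp.norm_sq_eq_of_L2, inner_self_eq_norm_sq_to_K]

theorem vectorFunctional_single [DecidableEq p] (η : PiLp 2 fun _ : p => H) (i j : p) :
    vectorFunctional η (Matrix.single i j 1) = ⟪η i, η j⟫_ℂ := by
  simp [vectorFunctional_apply, Matrix.single_apply, ite_and]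

theorem vectorFunctional_mul_conjTranspose (a : Matrix p n ℂ) (η : PiLp 2 fun _ : p => H) :
    vectorFunctional η (a * aᴴ) = (‖adjointAct a η‖ ^ 2 : ℝ) := by
  have hsq : ((‖adjointAct a η‖ ^ 2 : ℝ) : ℂ) = ⟪adjointAct a η, adjointAct a η⟫_ℂ := by
    simp [inner_self_eq_norm_sq_to_K]
  rw [hsq, PiLp.inner_apply, vectorFunctional_apply]
  simp only [adjointAct, sum_inner, inner_sum, inner_smul_left, inner_smul_right,
    Matrix.mul_apply, Matrix.conjTranspose_apply, Finset.mul_sum]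
  simp_rw [Finset.sum_comm (s := (Finset.univ : Finset n))]
  rw [Finset.sum_comm]
  refine Finset.sum_congr rfl fun i _ => Finset.sum_congr rfl fun j _ =>
    Finset.sum_congr rfl fun c _ => ?_
  simp only [starRingEnd_apply, star_star]
  ring

theorem sum_norm_sq_adjointAct_blockColumns (A : Matrix p (n × r) ℂ) (η : PiLp 2 fun _ : p => H) :
    ∑ s, ‖adjointAct (blockColumns A s) η‖ ^ 2 = ‖adjointAct A η‖ ^ 2 := by
  simp only [PiLp.norm_sq_eq_of_L2, Fintype.sum_prod_type]
  exact Finset.sum_comm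

theorem vectorFunctional_nonneg (η : PiLp 2 fun _ : p => H) {P : Matrix p p ℂ} (hP : 0 ≤ P) :
    0 ≤ vectorFunctional η P := by
  classical
  obtain ⟨N, rfl⟩ := CStarAlgebra.nonneg_iff_eq_mul_star_self.1 hP
  rw [Matrix.star_eq_conjTranspose, vectorFunctional_mul_conjTranspose]
  positivity

theorem norm_adjointAct_le [DecidableEq n] (A : Matrix p n ℂ)
    (η : PiLp 2 fun _ : p => H) : ‖adjointAct A η‖ ≤ ‖A‖ * ‖η‖ := by
  classical
  have hA : A * Aᴴ ≤ (‖A‖ ^ 2) • (1 : Matrix p p ℂ) :=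
    (mul_conjTranspose_le_smul_one_iff A (by positivity)).2 le_rfl
  have h := vectorFunctional_nonneg η (sub_nonneg.2 hA)
  rw [map_sub, LinearMap.map_smul_of_tower, vectorFunctional_one,
    vectorFunctional_mul_conjTranspose, sub_nonneg, Complex.real_smul, ← Complex.ofReal_mul,
    Complex.real_le_real, ← mul_pow] at h
  exact le_of_sq_le_sq h (by positivity)

end AdjointAct

section OpMatrix

variable {V : Type*} [AddCommGroup V] [Module ℂ V] {H : Type*} [NormedAddCommGroup H]
  [InnerProductSpace ℂ H] {k m : ℕ}

theorem inner_opMatrix (T : Matrix (Fin m) (Fin m) (H →L[ℂ] H)) (η ξ : PiLp 2 fun _ : Fin m => H) :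
    ⟪η, opMatrix T ξ⟫_ℂ = ∑ i, ∑ j, ⟪η i, T i j (ξ j)⟫_ℂ := by
  simp [PiLp.inner_apply, opMatrix_apply, inner_sum]

theorem inner_opMatrix_map_sum {ι : Type*} (s : Finset ι) (Φ : V →ₗ[ℂ] (H →L[ℂ] H))
    (X : ι → Matrix (Fin m) (Fin m) V) (η ξ : PiLp 2 fun _ : Fin m => H) :
    ⟪η, opMatrix ((∑ l ∈ s, X l).map Φ) ξ⟫_ℂ = ∑ l ∈ s, ⟪η, opMatrix ((X l).map Φ) ξ⟫_ℂ := by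
  simp only [inner_opMatrix, Matrix.map_apply, Matrix.sum_apply, map_sum, _root_.sum_apply,
    inner_sum]
  simp_rw [Finset.sum_comm (t := s)]

theorem inner_opMatrix_map_sandwich (Φ : V →ₗ[ℂ] (H →L[ℂ] H)) (a b : Matrix (Fin m) (Fin k) ℂ)
    (x : Matrix (Fin k) (Fin k) V) (η ξ : PiLp 2 fun _ : Fin m => H) :
    ⟪η, opMatrix ((sandwich a x b).map Φ) ξ⟫_ℂ =
      ⟪adjointAct a η, opMatrix (x.map Φ) (adjointAct b ξ)⟫_ℂ := by
  simp only [inner_opMatrix, adjointAct, Matrix.map_apply, sandwich, Matrix.of_apply,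
    map_sum, map_smul, _root_.sum_apply, _root_.smul_apply,
    inner_sum, sum_inner, inner_smul_left, inner_smul_right, Finset.mul_sum]
  simp_rw [Finset.sum_comm (s := (Finset.univ : Finset (Fin m)))
    (t := (Finset.univ : Finset (Fin k)))]
  refine Finset.sum_congr rfl fun c _ => Finset.sum_congr rfl fun d _ => ?_
  rw [Finset.sum_comm]
  refine Finset.sum_congr rfl fun i _ => Finset.sum_congr rfl fun j _ => ?_
  simp only [starRingEnd_apply, star_star]
  ring

theorem norm_opMatrix_map_sandwich_blockDiagonal_le {r : ℕ} {Φ : V →ₗ[ℂ] (H →L[ℂ] H)}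
    {x : Fin r → Matrix (Fin k) (Fin k) V} (hx : ∀ s, ‖opMatrix ((x s).map Φ)‖ ≤ 1)
    (A B : Matrix (Fin m) (Fin k × Fin r) ℂ) :
    ‖opMatrix ((sandwich A (Matrix.blockDiagonal x) B).map Φ)‖ ≤ ‖A‖ * ‖B‖ := by
  refine ContinuousLinearMap.opNorm_le_of_re_inner_le (by positivity) fun ξ η hξ hη => ?_
  rw [inner_re_symm, sandwich_blockDiagonal, inner_opMatrix_map_sum, map_sum]
  calc ∑ s, RCLike.re ⟪η, opMatrix ((sandwich (blockColumns A s) (x s)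
          (blockColumns B s)).map Φ) ξ⟫_ℂ
      ≤ ∑ s, ‖adjointAct (blockColumns A s) η‖ * ‖adjointAct (blockColumns B s) ξ‖ := by
        gcongr with s
        rw [inner_opMatrix_map_sandwich]
        refine (re_inner_le_norm _ _).trans ?_
        gcongr
        exact (opMatrix ((x s).map Φ)).le_of_opNorm_le_of_le (hx s) le_rfl |>.trans_eq (one_mul _)
    _ ≤ ‖adjointAct A η‖ * ‖adjointAct B ξ‖ := by
        refine (Real.sum_mul_le_sqrt_mul_sqrt _ _ _).trans_eq ?_
        simp only [sum_norm_sq_adjointAct_blockColumns, Real.sqrt_sq (norm_nonneg _)]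
    _ ≤ (‖A‖ * ‖η‖) * (‖B‖ * ‖ξ‖) := by
        gcongr <;> exact norm_adjointAct_le _ _
    _ = ‖A‖ * ‖B‖ := by rw [hη, hξ, mul_one, mul_one]

end OpMatrix

section Values

variable {V : Type*} [AddCommGroup V] [Module ℂ V] {k m : ℕ}

/-- The values `‖(Φ(X_ij))‖`, where `Φ` runs over the linear maps from `V` into the bounded
operators on some complex Hilbert space whose `k`-th amplification is contractive on `K ⊆ M_k(V)`.
For the unit ball `K` of `M_k(V)` these are the values defining the norm of `MAX^k(V)`. -/
def contractionValues (K : Set (Matrix (Fin k) (Fin k) V)) (X : Matrix (Fin m) (Fin m) V) : Set ℝ :=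
  {c | ∃ (H : Type w) (_ : NormedAddCommGroup H) (_ : InnerProductSpace ℂ H) (_ : CompleteSpace H)
      (Φ : V →ₗ[ℂ] (H →L[ℂ] H)), (∀ x ∈ K, ‖opMatrix (x.map Φ)‖ ≤ 1) ∧ c = ‖opMatrix (X.map Φ)‖}

/-- The numbers `‖A‖ ‖B‖` over all factorizations `X = A · diag(x_1, …, x_r) · B*` with `r ≥ 1` and
`x_1, …, x_r ∈ K`, where `K` is a subset of `M_k(V)` that replaces the unit ball. -/
def factorizationValuesOver (K : Set (Matrix (Fin k) (Fin k) V)) (X : Matrix (Fin m) (Fin m) V) :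
    Set ℝ :=
  {c | ∃ (r : ℕ) (_ : 1 ≤ r) (A B : Matrix (Fin m) (Fin k × Fin r) ℂ)
      (x : Fin r → Matrix (Fin k) (Fin k) V),
      (∀ s, x s ∈ K) ∧ X = sandwich A (Matrix.blockDiagonal x) B ∧ c = ‖A‖ * ‖B‖}

variable {K : Set (Matrix (Fin k) (Fin k) V)} {X : Matrix (Fin m) (Fin m) V}

theorem contractionValues_nonempty : (contractionValues.{w} K X).Nonempty := by
  refine ⟨_, EuclideanSpace ℂ PEmpty.{w + 1}, inferInstance, inferInstance, inferInstance, 0,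
    fun x _ => ?_, rfl⟩
  rw [Subsingleton.elim (opMatrix _) 0, norm_zero]
  exact zero_le_one

theorem le_of_mem_contractionValues_of_mem_factorizationValuesOver {c d : ℝ}
    (hc : c ∈ contractionValues.{w} K X) (hd : d ∈ factorizationValuesOver K X) : c ≤ d := by
  obtain ⟨H, _, _, _, Φ, hΦ, rfl⟩ := hc
  obtain ⟨r, _, A, B, x, hx, rfl, rfl⟩ := hd
  exact norm_opMatrix_map_sandwich_blockDiagonal_le (fun s => hΦ _ (hx s)) A B

theorem nonneg_of_mem_contractionValues {c : ℝ} (hc : c ∈ contractionValues.{w} K X) : 0 ≤ c := by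
  obtain ⟨H, _, _, _, Φ, -, rfl⟩ := hc
  exact norm_nonneg _

theorem bddBelow_factorizationValuesOver : BddBelow (factorizationValuesOver K X) := by
  refine ⟨0, ?_⟩
  rintro _ ⟨r, _, A, B, x, -, -, rfl⟩
  positivity

end Values

section Cone

variable {V : Type*} [AddCommGroup V] [Module ℂ V] {k m : ℕ}

/-- The triples `(P, Q, Y)` such that `Y = ∑ a_s x_s b_s*` for some `x_s ∈ K` with
`∑ a_s a_s* ≤ P` and `∑ b_s b_s* ≤ Q`. The matrices `P` and `Q` range over all of `M_m(ℂ)`, rather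
than over the Hermitian matrices, and only their real parts are compared. -/
def factorizationSet (K : Set (Matrix (Fin k) (Fin k) V)) (m : ℕ) :
    Set (Matrix (Fin m) (Fin m) ℂ × Matrix (Fin m) (Fin m) ℂ × Matrix (Fin m) (Fin m) V) :=
  {T | ∃ (r : ℕ) (_ : 1 ≤ r) (a b : Fin r → Matrix (Fin m) (Fin k) ℂ)
    (x : Fin r → Matrix (Fin k) (Fin k) V), (∀ s, x s ∈ K) ∧
    ∑ s, a s * (a s)ᴴ ≤ (ℜ T.1 : Matrix (Fin m) (Fin m) ℂ) ∧
    ∑ s, b s * (b s)ᴴ ≤ (ℜ T.2.1 : Matrix (Fin m) (Fin m) ℂ) ∧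
    T.2.2 = ∑ s, sandwich (a s) (x s) (b s)}

variable {K : Set (Matrix (Fin k) (Fin k) V)}

theorem add_mem_factorizationSet
    {T T' : Matrix (Fin m) (Fin m) ℂ × Matrix (Fin m) (Fin m) ℂ × Matrix (Fin m) (Fin m) V}
    (hT : T ∈ factorizationSet K m) (hT' : T' ∈ factorizationSet K m) :
    T + T' ∈ factorizationSet K m := by
  obtain ⟨r, hr, a, b, x, hx, ha, hb, hY⟩ := hT
  obtain ⟨r', -, a', b', x', hx', ha', hb', hY'⟩ := hT'
  refine ⟨r + r', by omega, Fin.append a a', Fin.append b b', Fin.append x x', ?_, ?_, ?_, ?_⟩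
  · exact Fin.addCases (by simpa using hx) (by simpa using hx')
  · simpa [Fin.sum_univ_add] using add_le_add ha ha'
  · simpa [Fin.sum_univ_add] using add_le_add hb hb'
  · simp [Fin.sum_univ_add, hY, hY']

theorem smul_mem_factorizationSet {t : ℝ} (ht : 0 ≤ t)
    {T : Matrix (Fin m) (Fin m) ℂ × Matrix (Fin m) (Fin m) ℂ × Matrix (Fin m) (Fin m) V}
    (hT : T ∈ factorizationSet K m) : t • T ∈ factorizationSet K m := by
  obtain ⟨r, hr, a, b, x, hx, ha, hb, hY⟩ := hT
  have hsqrt : ((√t : ℝ) : ℂ) * star ((√t : ℝ) : ℂ) = (t : ℂ) := by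
    rw [Complex.star_def, Complex.conj_ofReal, ← Complex.ofReal_mul, Real.mul_self_sqrt ht]
  have hmul (a : Matrix (Fin m) (Fin k) ℂ) :
      ((√t : ℝ) : ℂ) • a * (((√t : ℝ) : ℂ) • a)ᴴ = t • (a * aᴴ) := by
    rw [Matrix.conjTranspose_smul, Matrix.smul_mul, Matrix.mul_smul, smul_smul, hsqrt,
      Complex.coe_smul]
  refine ⟨r, hr, fun s => ((√t : ℝ) : ℂ) • a s, fun s => ((√t : ℝ) : ℂ) • b s, x, hx, ?_, ?_, ?_⟩
  · simpa only [hmul, ← Finset.smul_sum, Prod.smul_fst, Prod.smul_snd, map_smul,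
      selfAdjoint.val_smul]
      using smul_le_smul_of_nonneg_left ha ht
  · simpa only [hmul, ← Finset.smul_sum, Prod.smul_fst, Prod.smul_snd, map_smul,
      selfAdjoint.val_smul]
      using smul_le_smul_of_nonneg_left hb ht
  · simp_rw [sandwich_smul_smul, hsqrt, ← Finset.smul_sum, ← hY, Complex.coe_smul, Prod.smul_snd]

theorem zero_mem_factorizationSet (hK : K.Nonempty) : 0 ∈ factorizationSet K m := by
  obtain ⟨x, hx⟩ := hK
  exact ⟨1, le_rfl, 0, 0, fun _ => x, fun _ => hx, by simp, by simp, by simp [sandwich_zero_left]⟩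

/-- `factorizationSet K m` as a convex cone, to which the Hahn–Banach theorem is applied: if
`(t 1, t 1, X)` belongs to it, then `X` has a factorization with `‖A‖ ‖B‖ ≤ t`. -/
def factorizationCone (hK : K.Nonempty) (m : ℕ) : PointedCone ℝ
    (Matrix (Fin m) (Fin m) ℂ × Matrix (Fin m) (Fin m) ℂ × Matrix (Fin m) (Fin m) V) where
  carrier := factorizationSet K m
  add_mem' := add_mem_factorizationSet
  zero_mem' := zero_mem_factorizationSet hK
  smul_mem' t _ := smul_mem_factorizationSet t.2

theorem mk_mem_factorizationSet {x : Matrix (Fin k) (Fin k) V} (hx : x ∈ K)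
    (a b : Matrix (Fin m) (Fin k) ℂ) :
    (a * aᴴ, b * bᴴ, sandwich a x b) ∈ factorizationSet K m := by
  refine ⟨1, le_rfl, fun _ => a, fun _ => b, fun _ => x, fun _ => hx, ?_, ?_, by simp⟩
  · simp [(Matrix.isHermitian_mul_conjTranspose_self a).isSelfAdjoint.coe_realPart]
  · simp [(Matrix.isHermitian_mul_conjTranspose_self b).isSelfAdjoint.coe_realPart]

theorem factorizationSet_mono {P Q P' Q' : Matrix (Fin m) (Fin m) ℂ} {Y : Matrix (Fin m) (Fin m) V}
    (h : (P, Q, Y) ∈ factorizationSet K m) (hP : ℜ P ≤ ℜ P') (hQ : ℜ Q ≤ ℜ Q') :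
    (P', Q', Y) ∈ factorizationSet K m := by
  obtain ⟨r, hr, a, b, x, hx, ha, hb, hY⟩ := h
  exact ⟨r, hr, a, b, x, hx, ha.trans hP, hb.trans hQ, hY⟩

theorem exists_sandwich_mem_factorizationSet (hK : K.Nonempty) {x : Matrix (Fin k) (Fin k) V}
    (hx : x ∈ Submodule.span ℂ K) (a b : Matrix (Fin m) (Fin k) ℂ) :
    ∃ P Q, (P, Q, sandwich a x b) ∈ factorizationSet K m := by
  induction hx using Submodule.closure_induction with
  | zero => exact ⟨0, 0, by rw [sandwich_zero]; exact zero_mem_factorizationSet hK⟩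
  | add x y _ _ ihx ihy =>
    obtain ⟨P, Q, h⟩ := ihx
    obtain ⟨P', Q', h'⟩ := ihy
    exact ⟨P + P', Q + Q', by simpa [sandwich_add] using add_mem_factorizationSet h h'⟩
  | smul_mem c x hx =>
    rw [sandwich_smul]
    exact ⟨_, _, mk_mem_factorizationSet hx (c • a) b⟩

theorem exists_mem_factorizationSet (hk : 1 ≤ k) (hK : K.Nonempty)
    (hspan : Submodule.span ℂ K = ⊤) (Y : Matrix (Fin m) (Fin m) V) :
    ∃ P Q, (P, Q, Y) ∈ factorizationSet K m := by
  induction Y using Matrix.induction_on' with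
  | h_zero => exact ⟨0, 0, zero_mem_factorizationSet hK⟩
  | h_add Y Z hY hZ =>
    obtain ⟨P, Q, h⟩ := hY
    obtain ⟨P', Q', h'⟩ := hZ
    exact ⟨P + P', Q + Q', by simpa using add_mem_factorizationSet h h'⟩
  | h_std_basis i j v =>
    let c : Fin k := ⟨0, hk⟩
    have hv : Matrix.single c c v ∈ Submodule.span ℂ K := hspan ▸ Submodule.mem_top
    simpa [sandwich_single] using exists_sandwich_mem_factorizationSet hK hv
      (Matrix.single i c 1) (Matrix.single j c 1)

theorem exists_smul_one_add_mem_factorizationSet (hk : 1 ≤ k) (hK : K.Nonempty)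
    (hspan : Submodule.span ℂ K = ⊤)
    (T : Matrix (Fin m) (Fin m) ℂ × Matrix (Fin m) (Fin m) ℂ × Matrix (Fin m) (Fin m) V) :
    ∃ s : ℝ, 0 ≤ s ∧ s • (1, 1, 0) + T ∈ factorizationSet K m := by
  obtain ⟨P, Q, Y⟩ := T
  obtain ⟨P', Q', h⟩ := exists_mem_factorizationSet hk hK hspan Y
  have hle {s : ℝ} {R R' : Matrix (Fin m) (Fin m) ℂ} (hs : ‖R' - R‖ ≤ s) :
      ℜ R' ≤ ℜ (s • 1 + R) := by
    have h1 : ℜ (R' - R) ≤ s • 1 :=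
      (realPart_le_norm_smul_one _).trans (smul_le_smul_of_nonneg_right hs zero_le_one)
    rw [map_sub, sub_le_iff_le_add] at h1
    simpa using h1
  refine ⟨max ‖P' - P‖ ‖Q' - Q‖, by positivity, ?_⟩
  simpa using factorizationSet_mono h (hle (le_max_left _ _)) (hle (le_max_right _ _))

theorem exists_le_of_mem_factorizationSet {t : ℝ} (ht : 0 ≤ t) {Y : Matrix (Fin m) (Fin m) V}
    (h : (t • 1, t • 1, Y) ∈ factorizationSet K m) : ∃ c ∈ factorizationValuesOver K Y, c ≤ t := by
  obtain ⟨r, hr, a, b, x, hx, ha, hb, hY⟩ := h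
  let A : Matrix (Fin m) (Fin k × Fin r) ℂ := Matrix.of fun i q => a q.2 i q.1
  let B : Matrix (Fin m) (Fin k × Fin r) ℂ := Matrix.of fun i q => b q.2 i q.1
  have hA : ‖A‖ ^ 2 ≤ t := by
    rw [← mul_conjTranspose_le_smul_one_iff A ht, mul_conjTranspose_eq_sum_blockColumns]
    exact ha.trans_eq (by simp)
  have hB : ‖B‖ ^ 2 ≤ t := by
    rw [← mul_conjTranspose_le_smul_one_iff B ht, mul_conjTranspose_eq_sum_blockColumns]
    exact hb.trans_eq (by simp)
  refine ⟨‖A‖ * ‖B‖, ⟨r, hr, A, B, x, hx, ?_, rfl⟩, ?_⟩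
  · rw [sandwich_blockDiagonal]
    exact hY
  · linarith [two_mul_le_add_sq ‖A‖ ‖B‖]

theorem factorizationValuesOver_nonempty (hk : 1 ≤ k) (hK : K.Nonempty)
    (hspan : Submodule.span ℂ K = ⊤) (X : Matrix (Fin m) (Fin m) V) :
    (factorizationValuesOver K X).Nonempty := by
  obtain ⟨s, hs, h⟩ := exists_smul_one_add_mem_factorizationSet hk hK hspan (0, 0, X)
  obtain ⟨c, hc, -⟩ := exists_le_of_mem_factorizationSet hs (by simpa using h)
  exact ⟨c, hc⟩

end Cone

section Separation

variable {E : Type*} [AddCommGroup E] [Module ℝ E] {C : PointedCone ℝ E} {e v : E}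

theorem exists_linearMap_nonneg_of_neg_notMem (hunit : ∀ y : E, ∃ s : ℝ, s • e + y ∈ C)
    (he : -e ∉ C) : ∃ g : E →ₗ[ℝ] ℝ, (∀ x ∈ C, 0 ≤ g x) ∧ g e = 1 := by
  have he0 : e ≠ 0 := fun h => he (by simp [h])
  have hmem (s : ℝ) : s • e ∈ Submodule.span ℝ {e} :=
    Submodule.smul_mem _ s (Submodule.mem_span_singleton_self e)
  let f : E →ₗ.[ℝ] ℝ := LinearPMap.mkSpanSingleton e 1 he0
  have hf (s : ℝ) : f ⟨s • e, hmem s⟩ = s :=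
    (LinearPMap.mkSpanSingleton'_apply e (1 : ℝ) _ s (hmem s)).trans (by simp)
  have hnonneg (x : f.domain) (hxC : (x : E) ∈ C) : 0 ≤ f x := by
    obtain ⟨x, hx⟩ := x
    obtain ⟨s, rfl⟩ := Submodule.mem_span_singleton.1 hx
    by_contra! hs
    rw [hf s] at hs
    have := C.smul_mem (inv_nonneg.2 (neg_nonneg.2 hs.le)) hxC
    exact he (by simpa [smul_smul, hs.ne, inv_neg] using this)
  obtain ⟨g, hgf, hg⟩ := riesz_extension C f hnonneg
    (fun y => (hunit y).imp' (fun s => ⟨s • e, hmem s⟩) fun s hs => hs)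
  exact ⟨g, hg, by simpa using (hgf ⟨(1 : ℝ) • e, hmem 1⟩).trans (hf 1)⟩

theorem exists_linearMap_nonneg_of_notMem (he : e ∈ C) (hunit : ∀ y : E, ∃ s : ℝ, s • e + y ∈ C)
    (hv : v ∉ C) : ∃ g : E →ₗ[ℝ] ℝ, (∀ x ∈ C, 0 ≤ g x) ∧ g e = 1 ∧ g v ≤ 0 := by
  have hneg : -e ∉ C := fun hne => by
    have hline (s : ℝ) : s • e ∈ C := by
      rcases le_total 0 s with hs | hs
      · exact C.smul_mem hs he
      · simpa using C.smul_mem (neg_nonneg.2 hs) hne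
    obtain ⟨s, hs⟩ := hunit v
    exact hv (by simpa [← add_assoc, ← add_smul] using C.add_mem (hline (-s)) hs)
  let D : PointedCone ℝ E := C ⊔ PointedCone.hull ℝ {-v}
  have hnegD : -e ∉ D := fun hD => by
    obtain ⟨c, hc, w, hw, hcw⟩ := Submodule.mem_sup.1 hD
    obtain ⟨⟨l, hl⟩, rfl⟩ := Submodule.mem_span_singleton.1 hw
    have hlv : l • v = c + e := by
      rw [Nonneg.mk_smul, smul_neg, ← sub_eq_add_neg] at hcw
      rw [← neg_neg e, ← hcw]
      abel
    rcases hl.eq_or_lt with rfl | hl'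
    · rw [zero_smul] at hlv
      exact hneg (eq_neg_of_add_eq_zero_left hlv.symm ▸ hc)
    · have := C.smul_mem (inv_nonneg.2 hl) (C.add_mem hc he)
      exact hv (by rwa [← hlv, inv_smul_smul₀ hl'.ne'] at this)
  obtain ⟨g, hg, hge⟩ := exists_linearMap_nonneg_of_neg_notMem (C := D)
    (fun y => (hunit y).imp fun _ hs => Submodule.mem_sup_left hs) hnegD
  have hgv : 0 ≤ g (-v) :=
    hg _ (Submodule.mem_sup_right (Submodule.mem_span_singleton_self _))
  exact ⟨g, fun x hx => hg x (Submodule.mem_sup_left hx), hge, by simpa using hgv⟩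

end Separation

section PositiveFunctional

theorem exists_positiveLinearMap_re_eq {A : Type*} [NonUnitalRing A] [StarRing A] [PartialOrder A]
    [StarOrderedRing A] [Module ℂ A] [StarModule ℂ A] {p : A →ₗ[ℝ] ℝ}
    (hp : ∀ a, 0 ≤ ℜ a → 0 ≤ p a) : ∃ f : A →ₚ[ℂ] ℂ, ∀ a, (f a).re = p a := by
  let f : A →ₗ[ℂ] ℂ := Module.Dual.extendRCLike p
  have hre (a : A) : (f a).re = p a := Module.Dual.re_extendRCLike_apply (𝕜 := ℂ) p a
  have him (a : A) : (f a).im = -p (Complex.I • a) :=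
    Module.Dual.im_extendRCLike_apply (𝕜 := ℂ) p a
  refine ⟨.mk₀ f fun a ha => ?_, hre⟩
  have hsa : IsSelfAdjoint a := .of_nonneg ha
  have hrot : ℜ (Complex.I • a) = 0 := by
    rw [realPart_I_smul, hsa.imaginaryPart, neg_zero]
  have hker : p (Complex.I • a) = 0 := by
    refine le_antisymm ?_ (hp _ hrot.ge)
    simpa using hp (-(Complex.I • a)) (by simp [hrot])
  refine Complex.nonneg_iff.2 ⟨?_, by rw [him, hker, neg_zero]⟩
  rw [hre]
  exact hp a (by rwa [← Subtype.coe_le_coe, hsa.coe_realPart])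

variable {p : Type*}

theorem posSemidef_of_apply_single [Finite p] [DecidableEq p] (f : Matrix p p ℂ →ₚ[ℂ] ℂ) :
    (Matrix.of fun i j => f (Matrix.single i j 1)).PosSemidef := by
  have := Fintype.ofFinite p
  refine .of_dotProduct_mulVec_nonneg ?_ fun z => ?_
  · ext i j
    rw [Matrix.conjTranspose_apply, Matrix.of_apply, Matrix.of_apply, ← map_star,
      Matrix.star_eq_conjTranspose, Matrix.conjTranspose_single, star_one]
  · have hz : 0 ≤ f (Matrix.vecMulVec (star z) z) :=
      f.map_nonneg (Matrix.posSemidef_vecMulVec_star_self z).nonneg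
    convert hz
    have hsingle (i j : p) : Matrix.single i j (star (z i) * z j) =
        (star (z i) * z j) • Matrix.single i j (1 : ℂ) := by simp
    rw [Matrix.matrix_eq_sum_single (Matrix.vecMulVec (star z) z)]
    simp only [Matrix.vecMulVec_apply, Pi.star_apply, hsingle, map_sum, map_smul, smul_eq_mul,
      dotProduct, Matrix.mulVec, Matrix.of_apply, Finset.mul_sum]
    exact Finset.sum_congr rfl fun i _ => Finset.sum_congr rfl fun j _ => by ring

variable [Fintype p] {H : Type*} [NormedAddCommGroup H] [InnerProductSpace ℂ H]

theorem exists_basis_gram_eq (e : OrthonormalBasis p ℂ H) {G : Matrix p p ℂ} (hG : G.PosDef) :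
    ∃ η : Module.Basis p ℂ H, Matrix.gram ℂ η = G := by
  classical
  obtain ⟨S, rfl⟩ := CStarAlgebra.nonneg_iff_eq_star_mul_self.1 hG.posSemidef.nonneg
  let η (j : p) : H := e.repr.symm (WithLp.toLp 2 fun i => S i j)
  have hgram : Matrix.gram ℂ η = star S * S := by
    rw [Matrix.gram_eq_conjTranspose_mul e]
    simp only [η, LinearIsometryEquiv.apply_symm_apply]
    rfl
  have hli : LinearIndependent ℂ η := Matrix.linearIndependent_of_posDef_gram (hgram ▸ hG)
  have : FiniteDimensional ℂ H := e.toBasis.finiteDimensional_of_finite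
  refine ⟨basisOfLinearIndependentOfCardEqFinrank' η hli
    (Module.finrank_eq_card_basis e.toBasis).symm, ?_⟩
  rwa [coe_basisOfLinearIndependentOfCardEqFinrank']

theorem exists_basis_vectorFunctional_eq (e : OrthonormalBasis p ℂ H) (f : Matrix p p ℂ →ₚ[ℂ] ℂ)
    {ε : ℝ} (hε : 0 < ε) :
    ∃ η : Module.Basis p ℂ H, ∀ P, vectorFunctional (basisTuple η) P = f P + ε * P.trace := by
  classical
  have hG : ((Matrix.of fun i j => f (Matrix.single i j 1)) + ε • 1 : Matrix p p ℂ).PosDef :=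
    (Matrix.PosDef.one.smul hε).posSemidef_add (posSemidef_of_apply_single f)
  obtain ⟨η, hη⟩ := exists_basis_gram_eq e hG
  suffices h : vectorFunctional (basisTuple η) =
      f.toLinearMap + (ε : ℂ) • Matrix.traceLinearMap p ℂ ℂ from ⟨η, LinearMap.congr_fun h⟩
  refine Matrix.ext_linearMap ℂ fun i j => LinearMap.ext_ring ?_
  have hij : ⟪η i, η j⟫_ℂ = f (Matrix.single i j 1) + ε * (1 : Matrix p p ℂ) i j := by
    simpa [Matrix.gram_apply] using congr_fun₂ hη i j
  have htrace : (Matrix.single i j (1 : ℂ)).trace = (1 : Matrix p p ℂ) i j := by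
    rcases eq_or_ne i j with rfl | h
    · simp
    · rw [Matrix.trace_single_eq_of_ne _ _ _ h, Matrix.one_apply_ne h]
  simp [vectorFunctional_single, basisTuple, hij, htrace]

theorem exists_basis_norm_sq_eq_and_re_le [DecidableEq p] (e : OrthonormalBasis p ℂ H)
    (f : Matrix p p ℂ →ₚ[ℂ] ℂ) {ε : ℝ} (hε : 0 < ε) :
    ∃ η : Module.Basis p ℂ H, ‖basisTuple η‖ ^ 2 = (f 1).re + ε * Fintype.card p ∧
      ∀ {n : Type*} [Fintype n] (a : Matrix p n ℂ),
        (f (a * aᴴ)).re ≤ ‖adjointAct a (basisTuple η)‖ ^ 2 := by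
  obtain ⟨η, hη⟩ := exists_basis_vectorFunctional_eq e f hε
  have hre (P : Matrix p p ℂ) :
      (vectorFunctional (basisTuple η) P).re = (f P).re + ε * P.trace.re := by
    rw [hη, Complex.add_re, Complex.re_ofReal_mul]
  refine ⟨η, ?_, fun a => ?_⟩
  · have h := hre 1
    rwa [vectorFunctional_one, Complex.ofReal_re, Matrix.trace_one, Complex.natCast_re] at h
  · have htrace : 0 ≤ (a * aᴴ).trace.re :=
      (Complex.nonneg_iff.1 (Matrix.posSemidef_self_mul_conjTranspose a).trace_nonneg).1
    have h := hre (a * aᴴ)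
    rw [vectorFunctional_mul_conjTranspose, Complex.ofReal_re] at h
    exact h ▸ le_add_of_nonneg_right (mul_nonneg hε.le htrace)

end PositiveFunctional

section Representation

variable {p n H : Type*} [NormedAddCommGroup H] [InnerProductSpace ℂ H]

theorem exists_adjointAct_basis_eq [Fintype p] (η : Module.Basis p ℂ H)
    (ζ : PiLp 2 fun _ : n => H) :
    ∃ a : Matrix p n ℂ, adjointAct a (basisTuple η) = ζ := by
  refine ⟨Matrix.of fun i c => star (η.repr (ζ c) i), ?_⟩
  ext c
  simp [adjointAct, basisTuple, η.sum_repr]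

theorem exists_inner_basis_eq_ite [Finite p] [DecidableEq p] (η : Module.Basis p ℂ H) :
    ∃ ζ : p → H, ∀ i j, ⟪ζ i, η j⟫_ℂ = if j = i then 1 else 0 := by
  have : FiniteDimensional ℂ H := η.finiteDimensional_of_finite
  have : CompleteSpace H := FiniteDimensional.complete ℂ H
  refine ⟨fun i => (InnerProductSpace.toDual ℂ H).symm (η.coord i).toContinuousLinearMap,
    fun i j => ?_⟩
  simp [Finsupp.single_apply]

variable {V : Type*} [AddCommGroup V] [Module ℂ V] {k m : ℕ}

theorem exists_linearMap_inner_opMatrix_eq (η ξ : Module.Basis (Fin m) ℂ H)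
    (f : Matrix (Fin m) (Fin m) V →ₗ[ℂ] ℂ) :
    ∃ Φ : V →ₗ[ℂ] (H →L[ℂ] H), ∀ Y : Matrix (Fin m) (Fin m) V,
      ⟪basisTuple η, opMatrix (Y.map Φ) (basisTuple ξ)⟫_ℂ = f Y := by
  obtain ⟨ζ, hζ⟩ := exists_inner_basis_eq_ite η
  obtain ⟨θ, hθ⟩ := exists_inner_basis_eq_ite ξ
  have hζ' (i j : Fin m) : ⟪η j, ζ i⟫_ℂ = if j = i then 1 else 0 := by
    rw [← inner_conj_symm, hζ, apply_ite (starRingEnd ℂ), map_one, map_zero]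
  refine ⟨∑ i, ∑ j, (f ∘ₗ Matrix.singleLinearMap ℂ i j).smulRight
    (InnerProductSpace.rankOne ℂ (ζ i) (θ j)), fun Y => ?_⟩
  conv_rhs => rw [Matrix.matrix_eq_sum_single Y]
  simp [inner_opMatrix, basisTuple, hζ', hθ, _root_.sum_apply]

theorem norm_opMatrix_map_le_one {Φ : V →ₗ[ℂ] (H →L[ℂ] H)} {x : Matrix (Fin k) (Fin k) V}
    (η ξ : Module.Basis (Fin m) ℂ H)
    (h : ∀ a b : Matrix (Fin m) (Fin k) ℂ,
      2 * (⟪basisTuple η, opMatrix ((sandwich a x b).map Φ) (basisTuple ξ)⟫_ℂ).re ≤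
        ‖adjointAct a (basisTuple η)‖ ^ 2 + ‖adjointAct b (basisTuple ξ)‖ ^ 2) :
    ‖opMatrix (x.map Φ)‖ ≤ 1 := by
  refine ContinuousLinearMap.opNorm_le_of_re_inner_le zero_le_one fun u v hu hv => ?_
  obtain ⟨a, rfl⟩ := exists_adjointAct_basis_eq η v
  obtain ⟨b, rfl⟩ := exists_adjointAct_basis_eq ξ u
  rw [inner_re_symm, ← inner_opMatrix_map_sandwich, RCLike.re_to_complex]
  have hab := h a b
  rw [hu, hv] at hab
  linarith

end Representation

section Duality

variable {V : Type*} [AddCommGroup V] [Module ℂ V] {k m : ℕ} {K : Set (Matrix (Fin k) (Fin k) V)}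

theorem mem_factorizationSet_of_nonneg (hK : K.Nonempty) {P Q : Matrix (Fin m) (Fin m) ℂ}
    (hP : 0 ≤ ℜ P) (hQ : 0 ≤ ℜ Q) : (P, Q, 0) ∈ factorizationSet K m :=
  factorizationSet_mono (zero_mem_factorizationSet hK) (by rwa [map_zero]) (by rwa [map_zero])

theorem exists_linearMap_nonneg_on_factorizationSet (hk : 1 ≤ k) (hK : K.Nonempty)
    (hspan : Submodule.span ℂ K = ⊤) {t : ℝ} {X : Matrix (Fin m) (Fin m) V}
    (hX : (t • 1, t • 1, X) ∉ factorizationSet K m) :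
    ∃ (p q : Matrix (Fin m) (Fin m) ℂ →ₗ[ℝ] ℝ) (h : Matrix (Fin m) (Fin m) V →ₗ[ℝ] ℝ),
      (∀ P Q Y, (P, Q, Y) ∈ factorizationSet K m → 0 ≤ p P + q Q + h Y) ∧
      p 1 + q 1 = 1 ∧ t + h X ≤ 0 := by
  have hone : 0 ≤ ℜ (1 : Matrix (Fin m) (Fin m) ℂ) := by
    rw [← Subtype.coe_le_coe, (IsSelfAdjoint.one _).coe_realPart]
    exact zero_le_one
  obtain ⟨g, hg, hg1, hgX⟩ := exists_linearMap_nonneg_of_notMem (C := factorizationCone hK m)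
    (e := (1, 1, 0)) (mem_factorizationSet_of_nonneg hK hone hone)
    (fun T => (exists_smul_one_add_mem_factorizationSet hk hK hspan T).imp fun _ => And.right) hX
  have hsplit (P Q : Matrix (Fin m) (Fin m) ℂ) (Y : Matrix (Fin m) (Fin m) V) :
      g (P, Q, Y) = g (P, 0, 0) + g (0, Q, 0) + g (0, 0, Y) := by
    simp [← map_add]
  have hline : (t • 1, t • 1, X) = (t • (1, 1, 0) + (0, 0, X) :
      Matrix (Fin m) (Fin m) ℂ × Matrix (Fin m) (Fin m) ℂ × Matrix (Fin m) (Fin m) V) := by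
    simp
  refine ⟨g ∘ₗ .inl ℝ _ _, g ∘ₗ .inr ℝ _ _ ∘ₗ .inl ℝ _ _, g ∘ₗ .inr ℝ _ _ ∘ₗ .inr ℝ _ _,
    fun P Q Y hT => (hg _ hT).trans_eq (hsplit P Q Y), ?_, ?_⟩
  · have h0 : g (0, 0, 0) = 0 := map_zero g
    change g (1, 0, 0) + g (0, 1, 0) = 1
    linarith [hsplit 1 1 0]
  · rw [hline, map_add, map_smul, hg1, smul_eq_mul, mul_one] at hgX
    exact hgX

theorem exists_positiveLinearMap_of_notMem_factorizationSet (hk : 1 ≤ k) (hK : K.Nonempty)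
    (hspan : Submodule.span ℂ K = ⊤) {t : ℝ} {X : Matrix (Fin m) (Fin m) V}
    (hX : (t • 1, t • 1, X) ∉ factorizationSet K m) :
    ∃ (p q : Matrix (Fin m) (Fin m) ℂ →ₚ[ℂ] ℂ) (f : Matrix (Fin m) (Fin m) V →ₗ[ℂ] ℂ),
      (p 1).re + (q 1).re = 2 ∧ t ≤ (f X).re ∧
      ∀ x ∈ K, ∀ a b, 2 * (f (sandwich a x b)).re ≤ (p (a * aᴴ)).re + (q (b * bᴴ)).re := by
  obtain ⟨p₀, q₀, h, hnonneg, hone, hle⟩ :=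
    exists_linearMap_nonneg_on_factorizationSet hk hK hspan hX
  have hp₀ (P : Matrix (Fin m) (Fin m) ℂ) (hP : 0 ≤ ℜ P) : 0 ≤ p₀ P := by
    simpa using hnonneg P 0 0 (mem_factorizationSet_of_nonneg hK hP (map_zero _).ge)
  have hq₀ (Q : Matrix (Fin m) (Fin m) ℂ) (hQ : 0 ≤ ℜ Q) : 0 ≤ q₀ Q := by
    simpa using hnonneg 0 Q 0 (mem_factorizationSet_of_nonneg hK (map_zero _).ge hQ)
  obtain ⟨p, hp : ∀ P, (p P).re = 2 * p₀ P⟩ := exists_positiveLinearMap_re_eq (p := (2 : ℝ) • p₀)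
    fun P hP => mul_nonneg zero_le_two (hp₀ P hP)
  obtain ⟨q, hq : ∀ Q, (q Q).re = 2 * q₀ Q⟩ := exists_positiveLinearMap_re_eq (p := (2 : ℝ) • q₀)
    fun Q hQ => mul_nonneg zero_le_two (hq₀ Q hQ)
  let f : Matrix (Fin m) (Fin m) V →ₗ[ℂ] ℂ := Module.Dual.extendRCLike (-h)
  have hf (Y : Matrix (Fin m) (Fin m) V) : (f Y).re = -h Y :=
    Module.Dual.re_extendRCLike_apply (𝕜 := ℂ) _ Y
  refine ⟨p, q, f, by linarith [hp 1, hq 1], by linarith [hf X], fun x hx a b => ?_⟩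
  linarith [hnonneg _ _ _ (mk_mem_factorizationSet hx a b), hf (sandwich a x b), hp (a * aᴴ),
    hq (b * bᴴ)]

theorem exists_mem_contractionValues (hk : 1 ≤ k) (hK : K.Nonempty)
    (hspan : Submodule.span ℂ K = ⊤) {t ε : ℝ} (hε : 0 < ε) {X : Matrix (Fin m) (Fin m) V}
    (hX : (t • 1, t • 1, X) ∉ factorizationSet K m) :
    ∃ c ∈ contractionValues.{w} K X, t ≤ c * (1 + ε * m) := by
  obtain ⟨p, q, f, hpq, htf, hf⟩ :=
    exists_positiveLinearMap_of_notMem_factorizationSet hk hK hspan hX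
  let H : Type w := EuclideanSpace ℂ (ULift.{w} (Fin m))
  let e : OrthonormalBasis (Fin m) ℂ H :=
    (EuclideanSpace.basisFun (ULift.{w} (Fin m)) ℂ).reindex Equiv.ulift
  obtain ⟨η, hη, hpη⟩ := exists_basis_norm_sq_eq_and_re_le e p hε
  obtain ⟨ξ, hξ, hqξ⟩ := exists_basis_norm_sq_eq_and_re_le e q hε
  obtain ⟨Φ, hΦ⟩ := exists_linearMap_inner_opMatrix_eq η ξ f
  rw [Fintype.card_fin] at hη hξ
  refine ⟨‖opMatrix (X.map Φ)‖, ⟨H, inferInstance, inferInstance, inferInstance, Φ,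
    fun x hx => norm_opMatrix_map_le_one η ξ fun a b => ?_, rfl⟩, ?_⟩
  · rw [hΦ]
    exact (hf x hx a b).trans (add_le_add (hpη a) (hqξ b))
  · calc t ≤ (⟪basisTuple η, opMatrix (X.map Φ) (basisTuple ξ)⟫_ℂ).re := hΦ X ▸ htf
      _ ≤ ‖basisTuple η‖ * (‖opMatrix (X.map Φ)‖ * ‖basisTuple ξ‖) :=
        (re_inner_le_norm (𝕜 := ℂ) _ _).trans <|
          mul_le_mul_of_nonneg_left (ContinuousLinearMap.le_opNorm _ _) (norm_nonneg _)
      _ = ‖opMatrix (X.map Φ)‖ * (‖basisTuple η‖ * ‖basisTuple ξ‖) := by ring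
      _ ≤ ‖opMatrix (X.map Φ)‖ * (1 + ε * m) := by
        gcongr
        linarith [two_mul_le_add_sq ‖basisTuple η‖ ‖basisTuple ξ‖, hη, hξ]

end Duality

section General

variable {V : Type u} [AddCommGroup V] [Module ℂ V] {k m : ℕ}

theorem sInf_factorizationValuesOver_le_sSup_contractionValues (hk : 1 ≤ k)
    {K : Set (Matrix (Fin k) (Fin k) V)} (hK : K.Nonempty) (hspan : Submodule.span ℂ K = ⊤)
    {X : Matrix (Fin m) (Fin m) V} (hbdd : BddAbove (contractionValues.{w} K X)) :
    sInf (factorizationValuesOver K X) ≤ sSup (contractionValues.{w} K X) := by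
  by_contra! hlt
  obtain ⟨t, hSt, htI⟩ := exists_between hlt
  have hS : 0 ≤ sSup (contractionValues.{w} K X) :=
    Real.sSup_nonneg fun _ => nonneg_of_mem_contractionValues
  have hnotMem : (t • 1, t • 1, X) ∉ factorizationSet K m := fun hmem => by
    obtain ⟨c, hc, hct⟩ := exists_le_of_mem_factorizationSet (hS.trans hSt.le) hmem
    exact ((csInf_le bddBelow_factorizationValuesOver hc).trans hct).not_gt htI
  have hle (ε : ℝ) (hε : 0 < ε) : t ≤ sSup (contractionValues.{w} K X) * (1 + ε * m) := by
    obtain ⟨c, hc, htc⟩ := exists_mem_contractionValues.{w} hk hK hspan hε hnotMem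
    exact htc.trans (by gcongr; exact le_csSup hbdd hc)
  have hlim : Tendsto (fun ε : ℝ => sSup (contractionValues.{w} K X) * (1 + ε * m)) (𝓝[>] 0)
      (𝓝 (sSup (contractionValues.{w} K X))) := by
    refine (Continuous.tendsto' (by fun_prop) _ _ (by simp)).mono_left nhdsWithin_le_nhds
  exact (ge_of_tendsto hlim (eventually_mem_nhdsWithin.mono hle)).not_gt hSt

theorem theorem3p3_general (hk : 1 ≤ k) {K : Set (Matrix (Fin k) (Fin k) V)} (hK : K.Nonempty)
    (hspan : Submodule.span ℂ K = ⊤) (X : Matrix (Fin m) (Fin m) V) :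
    BddAbove (contractionValues.{w} K X) ∧ (factorizationValuesOver K X).Nonempty ∧
      sSup (contractionValues.{w} K X) = sInf (factorizationValuesOver K X) := by
  have hne : (factorizationValuesOver K X).Nonempty :=
    factorizationValuesOver_nonempty hk hK hspan X
  have hle {c d : ℝ} : c ∈ contractionValues.{w} K X → d ∈ factorizationValuesOver K X → c ≤ d :=
    le_of_mem_contractionValues_of_mem_factorizationValuesOver
  have hbdd : BddAbove (contractionValues.{w} K X) :=
    hne.imp fun _ hd _ hc => hle hc hd
  refine ⟨hbdd, hne, le_antisymm ?_ ?_⟩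
  · exact csSup_le contractionValues_nonempty fun c hc => le_csInf hne fun d hd => hle hc hd
  · exact sInf_factorizationValuesOver_le_sSup_contractionValues hk hK hspan hbdd

end General

section OperatorSpace

variable {V : Type u} [AddCommGroup V] [Module ℂ V] [OperatorSpace V] {k m : ℕ}

theorem ampNorm_le_one_iff {H : Type*} [NormedAddCommGroup H] [InnerProductSpace ℂ H]
    {Φ : V →ₗ[ℂ] (H →L[ℂ] H)} :
    ampNorm k Φ ≤ 1 ↔ ∀ x, OperatorSpace.matNorm k x ≤ 1 → ‖opMatrix (x.map Φ)‖ ≤ 1 := by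
  simp only [ampNorm, iSup₂_le_iff, ENNReal.ofReal_le_one]

theorem kMaxValues_eq_contractionValues (X : Matrix (Fin m) (Fin m) V) :
    kMaxValues.{u, w} k X = contractionValues.{w} {x | OperatorSpace.matNorm k x ≤ 1} X := by
  simp only [kMaxValues, contractionValues, ampNorm_le_one_iff, Set.mem_ofPred_eq]

theorem unitBall_nonempty :
    {x : Matrix (Fin k) (Fin k) V | OperatorSpace.matNorm k x ≤ 1}.Nonempty :=
  ⟨0, ((OperatorSpace.matNorm_eq_zero_iff k 0).2 rfl).trans_le zero_le_one⟩

theorem span_unitBall :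
    Submodule.span ℂ {x : Matrix (Fin k) (Fin k) V | OperatorSpace.matNorm k x ≤ 1} = ⊤ := by
  refine Submodule.eq_top_iff'.2 fun x => ?_
  have hN : 0 < OperatorSpace.matNorm k x + 1 := by
    linarith [OperatorSpace.matNorm_nonneg k x]
  have hc : ((OperatorSpace.matNorm k x + 1 : ℝ) : ℂ) ≠ 0 := Complex.ofReal_ne_zero.2 hN.ne'
  rw [← Submodule.smul_mem_iff _ (inv_ne_zero hc)]
  refine Submodule.subset_span ?_
  rw [Set.mem_ofPred_eq, OperatorSpace.matNorm_smul, norm_inv, Complex.norm_of_nonneg hN.le,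
    inv_mul_le_one₀ hN]
  exact le_add_of_nonneg_right zero_le_one

end OperatorSpace

end

theorem theorem3p3 {V : Type u} [AddCommGroup V] [Module ℂ V] [OperatorSpace V]
    (k : ℕ) (hk : 1 ≤ k) (m : ℕ) (X : Matrix (Fin m) (Fin m) V) :
    BddAbove (kMaxValues.{u, w} k X) ∧ (factorizationValues k X).Nonempty ∧
      kMaxNorm.{u, w} k X = sInf (factorizationValues k X) := by
  rw [kMaxNorm, kMaxValues_eq_contractionValues]
  exact theorem3p3_general hk unitBall_nonempty span_unitBall X
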